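/- Let $U$ be a finite-dimensional real Euclidean space and let $K\subset U$ be a smooth knot, i.e. the image of a smooth embedding $S^1\hookrightarrow U$, with a smooth arclength parametrization $s\mapsto x(s)$, $0\le s\le L$, where $L$ is the length of $K$ (regarded as an $L$-periodic map on $\mathbb R$). Let $V\subset C^\infty(U)$ be a linear subspace of finite dimension $N$, equipped with a Euclidean inner product, with norm $|\cdot|$, and such that $$\forall s\in[0,L]\ \ \exists v\in V:\quad d_{x(s)}v\,(x'(s))\neq 0 .$$ Let $S(V)$ be the unit sphere of $V$, $dS$ its area measure, and $\sigma_{N-1}$ its total area. For $s\in[0,L]$ let $\xi_s:V\to\mathbb R$ be the linear functional $\xi_s(v)=d_{x(s)}v\,(x'(s))$, let $\xi_s^\dagger\in V$ be the vector dual to $\xi_s$ with respect to the inner product of $V$ (it is nonzero by assumption), and set $\nu(s)=\xi_s^\dagger/|\xi_s^\dagger|\in S(V)$. For $v\in S(V)$ let $\mu_K(v)$ be the number of critical points of the restriction $v|_K$. Then for almost every $v\in S(V)$ the restriction $v|_K$ is a Morse function and has finitely many critical points, the function $\mu_K$ is integrable on $S(V)$, and $$\frac1{\sigma_{N-1}}\int_{S(V)}\mu_K(v)\,dS(v)=\frac1\pi\int_0^L|\nu'(s)|\,ds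 .$$ -/

import Mathlib

open MeasureTheory Set
open scoped Manifold ContDiff

noncomputable section

namespace KnotStat

/-- The space `C^∞(U)` of smooth real functions on a normed space `U`. -/
abbrev SmoothFn (U : Type*) [NormedAddCommGroup U] [NormedSpace ℝ U] :=
  ContMDiffMap 𝓘(ℝ, U) 𝓘(ℝ, ℝ) U ℝ ∞

/-- A smooth knot: the image of a smooth embedding of the circle. -/
def IsSmoothKnot {U : Type*} [NormedAddCommGroup U] [NormedSpace ℝ U] (K : Set U) : Prop :=
  ∃ f : Circle → U, Manifold.IsSmoothEmbedding (𝓡 1) 𝓘(ℝ, U) ∞ f ∧ range f = K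

/-- `x` is a smooth arclength parametrization, of length `L`, of the closed curve `K`. It is
regarded as an `L`-periodic map on `ℝ`, that is, as a map on `ℝ / Lℤ`. -/
structure IsArclengthParam {U : Type*} [NormedAddCommGroup U] [NormedSpace ℝ U]
    (x : ℝ → U) (L : ℝ) (K : Set U) : Prop where
  length_pos : 0 < L
  smooth : ContDiff ℝ ∞ x
  periodic : Function.Periodic x L
  unit_speed : ∀ s, ‖deriv x s‖ = 1
  injOn : InjOn x (Ico 0 L)
  image_eq : x '' Ico 0 L = K

section

variable {U : Type*} [NormedAddCommGroup U] [NormedSpace ℝ U]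

/-- Elements of `SmoothFn U` are differentiable in the usual sense. -/
theorem SmoothFn.differentiableAt (v : SmoothFn U) (p : U) : DifferentiableAt ℝ (v : U → ℝ) p :=
  (v.contMDiff.contDiff.differentiable (by simp)) p

/-- The linear functional `ξ_s : v ↦ d_{x(s)} v (x'(s))` on `C^∞(U)`. -/
def xi (x : ℝ → U) (s : ℝ) : SmoothFn U →ₗ[ℝ] ℝ where
  toFun v := fderiv ℝ (v : U → ℝ) (x s) (deriv x s)
  map_add' v w := by
    rw [ContMDiffMap.coe_add, fderiv_add (v.differentiableAt _) (w.differentiableAt _)]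
    rfl
  map_smul' c v := by
    rw [ContMDiffMap.coe_smul, fderiv_const_smul (v.differentiableAt _)]
    rfl

/-- The critical points of the restriction of `v` to the curve parametrized by `x`, as a set of
points of the curve. -/
def criticalPoints (x : ℝ → U) (v : U → ℝ) : Set U :=
  {p | ∃ s, x s = p ∧ deriv (fun t => v (x t)) s = 0}

/-- The number of critical points of the restriction of `v` to the curve parametrized by `x`
(meaningful when this number is finite). -/
def criticalCount (x : ℝ → U) (v : U → ℝ) : ℕ :=
  (criticalPoints x v).ncard

/-- The restriction of `v` to the curve parametrized by `x` is a Morse function: all its critical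
points are nondegenerate. -/
def IsMorseAlong (x : ℝ → U) (v : U → ℝ) : Prop :=
  ∀ s, deriv (fun t => v (x t)) s = 0 → deriv (deriv (fun t => v (x t))) s ≠ 0

variable {E : Type*} [NormedAddCommGroup E] [InnerProductSpace ℝ E] [FiniteDimensional ℝ E]

/-- The vector `ξ†` of the Euclidean space `E` that corresponds to a linear functional `ξ` on `E`
under the isomorphism induced by the inner product. -/
def dualVector (ξ : E →ₗ[ℝ] ℝ) : E :=
  haveI : CompleteSpace E := FiniteDimensional.complete ℝ E
  (InnerProductSpace.toDual ℝ E).symm (LinearMap.toContinuousLinearMap ξ)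

theorem inner_dualVector (ξ : E →ₗ[ℝ] ℝ) (e : E) : inner ℝ (dualVector ξ) e = ξ e := by
  simp [dualVector]

/-- The normalized dual `ν(s) = ξ†_s / |ξ†_s|` of the restriction of `ξ_s` to a Euclidean space `E`
of smooth functions, where `ι` is the inclusion of `E` in `C^∞(U)`. -/
def nu (x : ℝ → U) (ι : E →ₗ[ℝ] SmoothFn U) (s : ℝ) : E :=
  ‖dualVector (xi x s ∘ₗ ι)‖⁻¹ • dualVector (xi x s ∘ₗ ι)

end

/-- The area measure on the unit sphere of a Euclidean space. -/
def sphereArea (E : Type*) [NormedAddCommGroup E] [InnerProductSpace ℝ E] [FiniteDimensional ℝ E]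
    [MeasurableSpace E] [BorelSpace E] : Measure (Metric.sphere (0 : E) 1) :=
  (volume : Measure E).toSphere

end KnotStat

end

/-! Along the knot, the derivative of `v` at `s` is `|ξ†_s| ⟪ν(s), v⟫`, so the critical points of
`v` on the knot are the parameters at which the spherical curve `ν` crosses the hyperplane
orthogonal to `v`. The theorem is thus Crofton's formula for `ν`: the mean number of crossings is
the length of `ν` divided by `π`.

Crofton's formula is proved with inscribed polygons. By rotation invariance and additivity, two unit
vectors `a`, `b` are separated by the hyperplane of `v` for a proportion `∠ a b / π` of the `v`
(`sphereArea_signChangeSet`). Summing over a uniform partition, the mean number of sign changes of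
`⟪ν, v⟫` along the grid is the sum of angles over `π`, which tends to the length over `π`
(`tendsto_sum_angle`). For almost every `v` all zeros are simple (`ae_inner_deriv_ne_zero`), so the
sign changes eventually count them exactly. Fatou's lemma makes the zero count integrable; since it
dominates every sign-change count, dominated convergence identifies its integral. -/

namespace KnotStat

open Metric InnerProductGeometry Filter Topology
open scoped Pointwise

/-! ### Area of lunes and slabs on the sphere. -/

section SphereArea

variable {E : Type*} [NormedAddCommGroup E] [InnerProductSpace ℝ E]

/-- Any two orthonormal pairs are related by a linear isometry. -/
theorem exists_linearIsometryEquiv_map_pair {a b a' b' : E} (ha : ‖a‖ = 1) (hb : ‖b‖ = 1)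
    (hab : inner ℝ a b = 0) (ha' : ‖a'‖ = 1) (hb' : ‖b'‖ = 1) (hab' : inner ℝ a' b' = 0) :
    ∃ R : E ≃ₗᵢ[ℝ] E, R a = a' ∧ R b = b' := by
  let R₁ : E ≃ₗᵢ[ℝ] E := (ℝ ∙ (a - a'))ᗮ.reflection
  have h₁ : R₁ a = a' := Submodule.reflection_sub (ha.trans ha'.symm)
  -- This reflection swaps `R₁ b` and `b'`; both are orthogonal to `a'`, so it leaves `a'` fixed.
  let R₂ : E ≃ₗᵢ[ℝ] E := (ℝ ∙ (R₁ b - b'))ᗮ.reflection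
  have h₂ : R₂ (R₁ b) = b' := Submodule.reflection_sub (by simp [hb, hb'])
  have h₃ : inner ℝ a' (R₁ b) = 0 := by rw [← h₁, R₁.inner_map_map, hab]
  have h₄ : R₂ a' = a' := by
    apply Submodule.reflection_mem_subspace_eq_self
    rw [Submodule.mem_orthogonal_singleton_iff_inner_left, inner_sub_right, h₃, hab', sub_zero]
  exact ⟨R₁.trans R₂, by simp [h₁, h₄], by simp [h₂]⟩

/-- A nonnegative function that is additive on `[0, T]` is linear there. -/
theorem eq_div_mul_of_additive_of_nonneg {G : ℝ → ℝ} {T : ℝ} (hT : 0 < T)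
    (h0 : ∀ t, 0 ≤ t → t ≤ T → 0 ≤ G t)
    (hadd : ∀ s t, 0 ≤ s → 0 ≤ t → s + t ≤ T → G (s + t) = G s + G t)
    {t : ℝ} (ht0 : 0 ≤ t) (htT : t ≤ T) : G t = t / T * G T := by
  have hmul : ∀ (k : ℕ) (s : ℝ), 0 ≤ s → k * s ≤ T → G (k * s) = k * G s := by
    intro k s hs
    induction k with
    | zero =>
      intro _
      have := hadd 0 0 le_rfl le_rfl (by simpa using hT.le)
      simp only [add_zero, left_eq_add] at this
      simp [this]
    | succ k ih =>
      intro hk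
      push_cast at hk ⊢
      have hks : (0 : ℝ) ≤ k * s := by positivity
      rw [add_mul, one_mul, hadd _ _ hks hs (by linarith), ih (by linarith)]
      ring
  have hGT : 0 ≤ G T := h0 T hT.le le_rfl
  have hmono : ∀ s t, 0 ≤ s → s ≤ t → t ≤ T → G s ≤ G t := by
    intro s t hs hst ht
    have := hadd s (t - s) hs (by linarith) (by linarith)
    rw [add_sub_cancel] at this
    have := h0 (t - s) (by linarith) (by linarith)
    linarith
  -- Rounding `t` down to a multiple of `T / n` costs at most `G T / n`.
  have lower : ∀ (n : ℕ), 0 < n → ∀ t, 0 ≤ t → t ≤ T → t / T * G T - G T / n ≤ G t := by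
    intro n hn t ht0 htT
    have hn' : (0 : ℝ) < n := by exact_mod_cast hn
    have hGn : G (T / n) = G T / n := by
      have := hmul n (T / n) (by positivity) (by field_simp; exact le_rfl)
      rw [mul_div_cancel₀ _ hn'.ne'] at this
      rw [this]; field_simp
    have hk := Nat.floor_le (a := n * t / T) (by positivity)
    have hk' := Nat.lt_floor_add_one (n * t / T)
    set k := ⌊n * t / T⌋₊
    have h1 : k * (T / n) ≤ t := by
      rw [le_div_iff₀ hT] at hk
      rw [mul_div_assoc', div_le_iff₀ hn']; linarith
    have h2 := hmono _ _ (by positivity) h1 htT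
    rw [hmul k _ (by positivity) (h1.trans htT), hGn] at h2
    refine le_trans ?_ h2
    have h3 : n * t / T - 1 ≤ k := by linarith
    have h4 : t / T * G T - G T / n = (n * t / T - 1) * (G T / n) := by field_simp
    rw [h4]
    gcongr
  have lim : ∀ c : ℝ, Filter.Tendsto (fun n : ℕ => c - G T / n) Filter.atTop (nhds (c - 0)) :=
    fun c => tendsto_const_nhds.sub (tendsto_const_div_atTop_nhds_zero_nat _)
  have lower' : ∀ t, 0 ≤ t → t ≤ T → t / T * G T ≤ G t := by
    intro t ht0 htT
    have := le_of_tendsto (lim (t / T * G T)) (b := G t)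
      (by filter_upwards [Filter.eventually_gt_atTop 0] with n hn using lower n hn t ht0 htT)
    simpa using this
  -- The upper bound at `t` is the lower bound at `T - t`, by additivity.
  refine le_antisymm ?_ (lower' t ht0 htT)
  have h1 := lower' (T - t) (by linarith) (by linarith)
  have h2 := hadd t (T - t) ht0 (by linarith) (by linarith)
  rw [add_sub_cancel] at h2
  have h3 : (T - t) / T * G T = G T - t / T * G T := by field_simp
  linarith

theorem Ioo_smul_image_subset_ball (s : Set (sphere (0 : E) 1)) :
    Ioo (0 : ℝ) 1 • ((↑) '' s : Set E) ⊆ ball 0 1 \ {0} := by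
  rintro _ ⟨r, hr, _, ⟨v, -, rfl⟩, rfl⟩
  have hv : ‖(v : E)‖ = 1 := by simp
  refine ⟨?_, ?_⟩
  · simp [norm_smul, hv, abs_of_pos hr.1, hr.2]
  · have : (v : E) ≠ 0 := by intro h; simp [h] at hv
    simp [hr.1.ne', this]

/-- The set of points of the sphere that two vectors separate. -/
def signChangeSet (a b : E) : Set (sphere (0 : E) 1) :=
  {v | inner ℝ a (v : E) * inner ℝ b (v : E) < 0}

theorem measurableSet_signChangeSet [MeasurableSpace E] [BorelSpace E] (a b : E) :
    MeasurableSet (signChangeSet a b) :=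
  (isOpen_lt (by fun_prop) continuous_const).measurableSet

variable [FiniteDimensional ℝ E] [MeasurableSpace E] [BorelSpace E]

instance : IsFiniteMeasure (sphereArea E) :=
  inferInstanceAs (IsFiniteMeasure (volume : Measure E).toSphere)

/-- The area of the trace of a cone on the sphere, in terms of its volume in the unit ball. -/
theorem sphereArea_cone {A : Set E} (hA : MeasurableSet A)
    (hc : ∀ r : ℝ, 0 < r → ∀ v ∈ A, r • v ∈ A) :
    sphereArea E {v | (v : E) ∈ A} =
      Module.finrank ℝ E * volume (A ∩ (ball (0 : E) 1 \ {0})) := by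
  have hm : MeasurableSet {v : sphere (0 : E) 1 | (v : E) ∈ A} := measurable_subtype_coe hA
  rw [sphereArea, Measure.toSphere_apply' _ hm]
  congr 2
  apply Subset.antisymm
  · refine subset_inter ?_ (Ioo_smul_image_subset_ball _)
    rintro _ ⟨r, hr, _, ⟨v, hv, rfl⟩, rfl⟩
    exact hc r hr.1 _ hv
  · rintro w ⟨hw, hw1, hw0⟩
    have hn : 0 < ‖w‖ := norm_pos_iff.2 hw0
    refine ⟨‖w‖, ⟨hn, by simpa using hw1⟩, ‖w‖⁻¹ • w,
      ⟨⟨‖w‖⁻¹ • w, by simp [norm_smul, hn.ne']⟩, hc _ (inv_pos.2 hn) _ hw, rfl⟩, ?_⟩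
    simp [smul_smul, hn.ne']

/-- Passing to cones turns area into volume, which linear isometries preserve. -/
theorem sphereArea_signChangeSet_map (R : E ≃ₗᵢ[ℝ] E) (a b : E) :
    sphereArea E (signChangeSet (R a) (R b)) = sphereArea E (signChangeSet a b) := by
  have key : ∀ a b : E, sphereArea E (signChangeSet a b) = Module.finrank ℝ E *
      volume ({v : E | inner ℝ a v * inner ℝ b v < 0} ∩ (ball (0 : E) 1 \ {0})) := by
    intro a b
    refine sphereArea_cone (A := {v : E | inner ℝ a v * inner ℝ b v < 0})
      (isOpen_lt (by fun_prop) continuous_const).measurableSet ?_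
    intro r hr v hv
    simp only [mem_ofPred_eq, inner_smul_right] at hv ⊢
    nlinarith [mul_pos hr hr]
  rw [key, key, ← R.measurePreserving.measure_preimage_emb
    R.toHomeomorph.measurableEmbedding]
  congr 2
  ext v
  simp

/-- The area of a neighbourhood of a great hypersphere. -/
theorem exists_sphereArea_slab_le : ∃ C : ℝ, 0 ≤ C ∧ ∀ (e : E), ‖e‖ = 1 → ∀ δ : ℝ, 0 ≤ δ →
    sphereArea E {v | |inner ℝ e (v : E)| ≤ δ} ≤ ENNReal.ofReal (C * δ) := by
  classical
  set N := Module.finrank ℝ E with hN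
  -- The cone over the slab lies in a box with one side `2 * δ`, along `e`, and `N - 1` sides `2`;
  -- the factor `N` relates area to the volume of the cone.
  refine ⟨N * (2 * 2 ^ (N - 1)), by positivity, fun e he δ hδ => ?_⟩
  have hpos : 0 < N := by
    have : Nontrivial E := ⟨e, 0, by intro h; simp [h] at he⟩
    exact Module.finrank_pos
  let i₀ : Fin N := ⟨0, hpos⟩
  obtain ⟨b, hb⟩ := Orthonormal.exists_orthonormalBasis_extension_of_card_eq (𝕜 := ℝ) (E := E)
    (ι := Fin N) (by simp [hN]) (v := fun _ => e) (s := {i₀})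
    ⟨fun _ => by simpa using he, fun i j hij => absurd (Subsingleton.elim i j) hij⟩
  have hb0 : b i₀ = e := hb i₀ rfl
  let c : Fin N → ℝ := Function.update (fun _ => 1) i₀ δ
  have hsub : Ioo (0 : ℝ) 1 • ((↑) '' {v : sphere (0 : E) 1 | |inner ℝ e (v : E)| ≤ δ} : Set E) ⊆
      b.repr ⁻¹' ((@WithLp.ofLp 2 (Fin N → ℝ)) ⁻¹' (univ.pi fun i => Icc (-(c i)) (c i))) := by
    rintro _ ⟨r, hr, _, ⟨v, hv, rfl⟩, rfl⟩
    have hv1 : ‖(v : E)‖ = 1 := by simp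
    simp only [mem_preimage, mem_univ_pi, mem_ofPred_eq] at hv ⊢
    intro i
    rw [mem_Icc, ← abs_le]
    simp only [b.repr_apply_apply, inner_smul_right, abs_mul, abs_of_pos hr.1]
    by_cases hi : i = i₀
    · subst hi
      simp only [c, Function.update_self, hb0]
      nlinarith [abs_nonneg (inner ℝ e (v : E)), hr.2, hr.1]
    · simp only [c, Function.update_of_ne hi]
      have : |inner ℝ (b i) (v : E)| ≤ 1 := by
        simpa [hv1] using abs_real_inner_le_norm (b i) (v : E)
      nlinarith [abs_nonneg (inner ℝ (b i) (v : E)), hr.2, hr.1]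
  have hm : MeasurableSet {v : sphere (0 : E) 1 | |inner ℝ e (v : E)| ≤ δ} :=
    (isClosed_le (by fun_prop) continuous_const).measurableSet
  have hbox : MeasurableSet (univ.pi fun i => Icc (-(c i)) (c i)) :=
    MeasurableSet.univ_pi fun _ => measurableSet_Icc
  have hvol : volume (univ.pi fun i => Icc (-(c i)) (c i)) =
      ENNReal.ofReal (2 * 2 ^ (N - 1) * δ) := by
    have h2 : (∏ i, (c i - -(c i))) = 2 * 2 ^ (N - 1) * δ := by
      simp only [sub_neg_eq_add, ← two_mul, Finset.prod_mul_distrib, Finset.prod_const,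
        Finset.card_univ, Fintype.card_fin]
      simp only [c, Finset.prod_update_of_mem (Finset.mem_univ i₀), Finset.prod_const_one, mul_one]
      rw [← pow_succ', Nat.sub_add_cancel hpos]
    rw [volume_pi_pi, ← h2, ENNReal.ofReal_prod_of_nonneg]
    · simp only [Real.volume_Icc]
    intro i _
    by_cases hi : i = i₀
    · subst hi; simp [c, hδ]
    · simp [c, Function.update_of_ne hi]
  rw [sphereArea, Measure.toSphere_apply' _ hm]
  calc _ ≤ (N : ENNReal) * volume (b.repr ⁻¹' ((@WithLp.ofLp 2 (Fin N → ℝ)) ⁻¹'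
          (univ.pi fun i => Icc (-(c i)) (c i)))) := by gcongr
    _ = N * ENNReal.ofReal (2 * 2 ^ (N - 1) * δ) := by
      rw [b.measurePreserving_repr.measure_preimage
          ((PiLp.volume_preserving_ofLp (Fin N)).measurable hbox).nullMeasurableSet,
        (PiLp.volume_preserving_ofLp (Fin N)).measure_preimage hbox.nullMeasurableSet, hvol]
    _ = _ := by
      rw [← ENNReal.ofReal_natCast, ← ENNReal.ofReal_mul (by positivity)]
      congr 1; ring

theorem ae_sphereArea_inner_ne_zero {e : E} (he : ‖e‖ = 1) :
    ∀ᵐ v : sphere (0 : E) 1 ∂(sphereArea E), inner ℝ e (v : E) ≠ 0 := by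
  obtain ⟨C, -, hC⟩ := exists_sphereArea_slab_le (E := E)
  have := hC e he 0 le_rfl
  simp only [mul_zero, ENNReal.ofReal_zero, nonpos_iff_eq_zero, abs_nonpos_iff] at this
  simpa [ae_iff] using this

/-- Additivity of the area of a lune in the angle. -/
theorem sphereArea_signChangeSet_add {a b c : E} (ha : ‖a‖ = 1) (hb : ‖b‖ = 1) (hc : ‖c‖ = 1)
    {p q r : ℝ} (hp : 0 ≤ p) (hq : 0 ≤ q) (hr : 0 ≤ r) (hpq : 0 < p ∨ 0 < q)
    (h : r • b = p • a + q • c) :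
    (sphereArea E).real (signChangeSet a c) =
      (sphereArea E).real (signChangeSet a b) + (sphereArea E).real (signChangeSet b c) := by
  have hin : ∀ v : E, r * inner ℝ b v = p * inner ℝ a v + q * inner ℝ c v := by
    intro v
    have := congrArg (fun w => inner ℝ w v) h
    simpa [inner_add_left, inner_smul_left] using this
  -- If `v` separated `b` from both `a` and `c`, then `p • a + q • c` would lie strictly on the side
  -- opposite to `b`, against `h`.
  have hdisj : Disjoint (signChangeSet a b) (signChangeSet b c) := by
    rw [Set.disjoint_left]
    intro v h1 h2
    simp only [signChangeSet, mem_ofPred_eq] at h1 h2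
    have := hin v
    rcases mul_neg_iff.1 h1 with ⟨h3, h4⟩ | ⟨h3, h4⟩
    · have h5 : 0 < inner ℝ c (v : E) := by
        by_contra h6; nlinarith
      rcases hpq with h6 | h6 <;> nlinarith [mul_pos h6 h3, mul_pos h6 h5,
        mul_nonneg hp h3.le, mul_nonneg hq h5.le, mul_nonneg hr (neg_nonneg.2 h4.le)]
    · have h5 : inner ℝ c (v : E) < 0 := by
        by_contra h6; nlinarith
      rcases hpq with h6 | h6 <;> nlinarith [mul_pos h6 (neg_pos.2 h3), mul_pos h6 (neg_pos.2 h5),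
        mul_nonneg hp (neg_nonneg.2 h3.le), mul_nonneg hq (neg_nonneg.2 h5.le),
        mul_nonneg hr h4.le]
  rw [← measureReal_union hdisj (measurableSet_signChangeSet _ _)]
  -- Off three null sets no sign vanishes, so `a` and `c` differ in sign exactly when one of the two
  -- consecutive pairs does.
  apply measureReal_congr
  filter_upwards [ae_sphereArea_inner_ne_zero ha, ae_sphereArea_inner_ne_zero hb,
    ae_sphereArea_inner_ne_zero hc] with v h1 h2 h3
  have hd : v ∈ signChangeSet a b → v ∉ signChangeSet b c := fun h => Set.disjoint_left.1 hdisj h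
  apply propext
  change v ∈ signChangeSet a c ↔ v ∈ signChangeSet a b ∪ signChangeSet b c
  simp only [signChangeSet, mem_ofPred_eq, mem_union, mul_neg_iff] at hd ⊢
  rcases lt_or_gt_of_ne h1 with h1 | h1 <;> rcases lt_or_gt_of_ne h2 with h2 | h2 <;>
  rcases lt_or_gt_of_ne h3 with h3 | h3 <;> simp_all [not_lt_of_gt]

theorem sphereArea_signChangeSet_self (a : E) :
    (sphereArea E).real (signChangeSet a a) = 0 := by
  have : signChangeSet a a = ∅ := by
    ext v; simp [signChangeSet, mul_self_nonneg]
  simp [this]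

theorem sphereArea_signChangeSet_neg {a : E} (ha : ‖a‖ = 1) :
    (sphereArea E).real (signChangeSet a (-a)) = (sphereArea E).real univ := by
  apply measureReal_congr
  filter_upwards [ae_sphereArea_inner_ne_zero ha] with v h1
  apply propext
  change v ∈ signChangeSet a (-a) ↔ v ∈ univ
  simpa [signChangeSet] using h1

/-- Two unit vectors separate a proportion `∠ a b / π` of the sphere. -/
theorem sphereArea_signChangeSet {a b : E} (ha : ‖a‖ = 1) (hb : ‖b‖ = 1) :
    (sphereArea E).real (signChangeSet a b) = angle a b / Real.pi * (sphereArea E).real univ := by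
  have ha0 : a ≠ 0 := by intro h; simp [h] at ha
  have hcos : inner ℝ a b = Real.cos (angle a b) := inner_eq_cos_angle_of_norm_eq_one ha hb
  by_cases hs : Real.sin (angle a b) = 0
  · rcases sin_eq_zero_iff_angle_eq_zero_or_angle_eq_pi.1 hs with h | h
    · have : a = b := eq_of_angle_eq_zero_of_norm_eq h (ha.trans hb.symm)
      subst this
      rw [sphereArea_signChangeSet_self, h]; simp
    · have : b = -a := by
        have h' : angle a (-b) = 0 := by rw [angle_neg_right, h, sub_self]
        rw [eq_of_angle_eq_zero_of_norm_eq h' (by simp [ha, hb]), neg_neg]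
      rw [h, this, sphereArea_signChangeSet_neg ha, div_self Real.pi_ne_zero, one_mul]
  set φ := angle a b with hφ
  -- Gram–Schmidt: `γ` below is the great circle from `a` through `b = γ φ` to `-a = γ π`. The area
  -- separated by `a` and `γ t` is additive in `t`, hence linear on `[0, π]`.
  let e : E := (Real.sin φ)⁻¹ • (b - Real.cos φ • a)
  have haa : inner ℝ a a = (1 : ℝ) := by simp [ha]
  have hbb : inner ℝ b b = (1 : ℝ) := by simp [hb]
  have hba : inner ℝ b a = Real.cos φ := by rw [real_inner_comm, hcos]
  have hae : inner ℝ a e = 0 := by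
    simp only [e, inner_smul_right, inner_sub_right, hcos, haa]; simp
  have hee : ‖e‖ = 1 := by
    have : inner ℝ e e = (1 : ℝ) := by
      simp only [e, inner_smul_right, inner_smul_left, inner_sub_right, inner_sub_left, hcos, haa,
        hbb, hba]
      simp only [conj_trivial]
      have := Real.sin_sq_add_cos_sq φ
      field_simp
      linarith
    rw [real_inner_self_eq_norm_sq] at this
    nlinarith [norm_nonneg e]
  let γ : ℝ → E := fun t => Real.cos t • a + Real.sin t • e
  have hγ : ∀ t, ‖γ t‖ = 1 := by
    intro t
    have : ‖γ t‖ ^ 2 = 1 := by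
      rw [norm_add_sq_real]
      simp [inner_smul_left, inner_smul_right, hae, norm_smul, ha, hee]
    nlinarith [norm_nonneg (γ t)]
  have hshift : ∀ s t, (sphereArea E).real (signChangeSet (γ s) (γ (s + t))) =
      (sphereArea E).real (signChangeSet a (γ t)) := by
    intro s t
    have h1 : ‖-Real.sin s • a + Real.cos s • e‖ = 1 := by
      have : ‖-Real.sin s • a + Real.cos s • e‖ ^ 2 = 1 := by
        rw [norm_add_sq_real]
        simp [inner_smul_left, inner_smul_right, hae, norm_smul, ha, hee]
      nlinarith [norm_nonneg (-Real.sin s • a + Real.cos s • e)]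
    have h2 : inner ℝ (γ s) (-Real.sin s • a + Real.cos s • e) = 0 := by
      have hea : inner ℝ e a = 0 := by rw [real_inner_comm, hae]
      simp [γ, inner_add_left, inner_add_right, inner_smul_left, inner_smul_right, hae, hea, ha,
        hee]
      ring
    obtain ⟨R, hRa, hRe⟩ := exists_linearIsometryEquiv_map_pair ha hee hae (hγ s) h1 h2
    have h3 : R (γ t) = γ (s + t) := by
      simp only [γ, map_add, map_smul, hRa, hRe, Real.cos_add, Real.sin_add]
      module
    rw [← h3, ← hRa, measureReal_def, sphereArea_signChangeSet_map, measureReal_def]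
  have key := eq_div_mul_of_additive_of_nonneg
    (G := fun t => (sphereArea E).real (signChangeSet a (γ t))) Real.pi_pos
    (fun _ _ _ => measureReal_nonneg) ?_ (angle_nonneg a b) (angle_le_pi a b)
  · have hb' : γ φ = b := by
      simp only [γ, e, smul_smul, mul_inv_cancel₀ hs]; simp
    have hp' : γ Real.pi = -a := by simp [γ]
    simp only [← hφ, hb', hp'] at key
    rw [key, sphereArea_signChangeSet_neg ha]
  · intro s t hs ht hst
    have hγ0 : γ 0 = a := by simp [γ]
    rcases hs.eq_or_lt with rfl | hs'
    · simp [hγ0, sphereArea_signChangeSet_self]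
    rcases ht.eq_or_lt with rfl | ht'
    · simp [hγ0, sphereArea_signChangeSet_self]
    rw [← hshift s t]
    -- The relation used is `sin (s + t) • γ s = sin t • a + sin s • γ (s + t)`.
    refine sphereArea_signChangeSet_add ha (hγ _) (hγ _)
      (Real.sin_nonneg_of_nonneg_of_le_pi ht (by linarith))
      (Real.sin_nonneg_of_nonneg_of_le_pi hs (by linarith))
      (Real.sin_nonneg_of_nonneg_of_le_pi (by linarith) hst)
      (Or.inr (Real.sin_pos_of_pos_of_lt_pi hs' (by linarith))) ?_
    have h1 : Real.sin t = Real.sin (s + t) * Real.cos s - Real.cos (s + t) * Real.sin s := by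
      rw [← Real.sin_sub, add_sub_cancel_left]
    simp only [γ]
    rw [h1]
    module

end SphereArea

/-! ### Angles, arc length and degenerate zeros for `C^2` curves. -/

section Curve

variable {E : Type*} [NormedAddCommGroup E]

/-- Uniform first order Taylor estimates for a `C^2` curve on a compact interval. -/
theorem exists_taylor_bound [NormedSpace ℝ E] {γ : ℝ → E} (hγ : ContDiff ℝ 2 γ) (L : ℝ) :
    ∃ C : ℝ, 0 ≤ C ∧ ∀ s ∈ Icc 0 L, ∀ t ∈ Icc 0 L, ‖deriv γ s‖ ≤ C ∧
      ‖deriv γ t - deriv γ s‖ ≤ C * |t - s| ∧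
      ‖γ t - γ s - (t - s) • deriv γ s‖ ≤ C * (t - s) ^ 2 := by
  have hγ' : ContDiff ℝ 1 (deriv γ) := by
    have : ContDiff ℝ (1 + 1) γ := by simpa [one_add_one_eq_two] using hγ
    exact (contDiff_succ_iff_deriv.1 this).2.2
  have hdiff : Differentiable ℝ γ := hγ.differentiable (by simp)
  have hdiff' : Differentiable ℝ (deriv γ) := hγ'.differentiable (by simp)
  obtain ⟨C₁, hC₁⟩ := isCompact_Icc.exists_bound_of_continuousOn
    (s := Icc 0 L) hγ'.continuous.continuousOn
  obtain ⟨C₂, hC₂⟩ := isCompact_Icc.exists_bound_of_continuousOn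
    (s := Icc 0 L) (hγ'.continuous_deriv le_rfl).continuousOn
  have hlip : ∀ s ∈ Icc 0 L, ∀ t ∈ Icc 0 L,
      ‖deriv γ t - deriv γ s‖ ≤ max 0 (max C₁ C₂) * |t - s| := by
    intro s hs t ht
    rw [← Real.norm_eq_abs]
    exact (convex_Icc 0 L).norm_image_sub_le_of_norm_deriv_le (fun x _ => hdiff' x)
      (fun x hx => (hC₂ x hx).trans (by simp)) hs ht
  refine ⟨max 0 (max C₁ C₂), by simp, fun s hs t ht => ⟨(hC₁ s hs).trans (by simp),
    hlip s hs t ht, ?_⟩⟩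
  set C := max 0 (max C₁ C₂)
  have hsub : uIcc s t ⊆ Icc 0 L := ordConnected_Icc.uIcc_subset hs ht
  -- Mean value inequality for the curve minus its linear part at `s`; the derivative is at most `C
  -- * |t - s|` between `s` and `t`.
  have hd : ∀ x ∈ uIcc s t, HasDerivWithinAt (fun x => γ x - (x - s) • deriv γ s)
      (deriv γ x - deriv γ s) (uIcc s t) x := by
    intro x _
    have h1 : HasDerivAt (fun x => (x - s) • deriv γ s) ((1 : ℝ) • deriv γ s) x :=
      ((hasDerivAt_id x).sub_const s).smul_const _
    rw [one_smul] at h1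
    exact ((hdiff x).hasDerivAt.sub h1).hasDerivWithinAt
  have := (convex_uIcc s t).norm_image_sub_le_of_norm_hasDerivWithin_le hd (C := C * |t - s|)
    (fun x hx => (hlip s hs x (hsub hx)).trans
      (mul_le_mul_of_nonneg_left (abs_sub_left_of_mem_uIcc hx) (by simp [C])))
    left_mem_uIcc right_mem_uIcc
  calc _ = ‖γ t - (t - s) • deriv γ s - (γ s - (s - s) • deriv γ s)‖ := by
        congr 1; simp only [sub_self, zero_smul]; abel
    _ ≤ C * |t - s| * ‖t - s‖ := this
    _ = C * (t - s) ^ 2 := by rw [Real.norm_eq_abs, mul_assoc, ← sq, sq_abs]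

variable [InnerProductSpace ℝ E]

/-- The angle between unit vectors agrees with their distance up to second order. -/
theorem abs_angle_sub_norm_sub_le {a b : E} (ha : ‖a‖ = 1) (hb : ‖b‖ = 1) :
    |angle a b - ‖a - b‖| ≤ ‖a - b‖ ^ 2 := by
  set θ := angle a b
  have hcos : inner ℝ a b = Real.cos θ := inner_eq_cos_angle_of_norm_eq_one ha hb
  have hθ0 : 0 ≤ θ := angle_nonneg a b
  have hθp : θ ≤ Real.pi := angle_le_pi a b
  have hsin0 : 0 ≤ Real.sin (θ / 2) :=
    Real.sin_nonneg_of_nonneg_of_le_pi (by linarith) (by linarith)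
  have hd : ‖a - b‖ = 2 * Real.sin (θ / 2) := by
    have h1 : ‖a - b‖ ^ 2 = (2 * Real.sin (θ / 2)) ^ 2 := by
      rw [norm_sub_sq_real, hcos, ha, hb, mul_pow, Real.sin_sq_eq_half_sub]
      ring_nf
    exact (sq_eq_sq₀ (norm_nonneg _) (by positivity)).1 h1
  rw [hd]
  have h1 : Real.sin (θ / 2) ≤ θ / 2 := Real.sin_le (by linarith)
  have h2 : 2 / Real.pi * (θ / 2) ≤ Real.sin (θ / 2) := Real.mul_le_sin (by linarith) (by linarith)
  have h3 : θ / 2 - (θ / 2) ^ 3 / 6 ≤ Real.sin (θ / 2) := by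
    rcases hθ0.eq_or_lt with h | h
    · rw [← h]; simp
    · exact (Real.sin_gt_sub_cube (by linarith)).le
  -- With `y = sin (θ / 2)`, this turns the cubic error `(θ / 2) ^ 3 / 3` into at most `8 * y ^ 3 /
  -- 3`, which is below `(2 * y) ^ 2` since `y ≤ 1`.
  have h4 : θ / 2 ≤ 2 * Real.sin (θ / 2) := by
    have : (1 : ℝ) / 2 ≤ 2 / Real.pi := by
      rw [div_le_div_iff₀ (by norm_num) Real.pi_pos]; linarith [Real.pi_le_four]
    nlinarith
  have h5 := Real.sin_le_one (θ / 2)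
  rw [abs_of_nonneg (by linarith)]
  set y := Real.sin (θ / 2)
  have h6 : (θ / 2) ^ 3 ≤ (2 * y) ^ 3 := pow_le_pow_left₀ (by linarith) h4 3
  nlinarith [mul_nonneg (sq_nonneg y) (sub_nonneg.2 h5)]

/-- The angle between nearby points of a `C^2` curve on the unit sphere agrees with the length of
the arc between them up to second order. -/
theorem exists_angle_sub_integral_bound {γ : ℝ → E} (hγ : ContDiff ℝ 2 γ) (h1 : ∀ s, ‖γ s‖ = 1)
    (L : ℝ) : ∃ C : ℝ, 0 ≤ C ∧ ∀ s ∈ Icc 0 L, ∀ t ∈ Icc 0 L, s ≤ t →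
      |angle (γ s) (γ t) - ∫ u in s..t, ‖deriv γ u‖| ≤ C * (t - s) ^ 2 := by
  obtain ⟨C, hC, H⟩ := exists_taylor_bound hγ L
  -- Three errors: angle to chord, chord to `(t - s) * ‖deriv γ s‖`, and that to the integral.
  refine ⟨C ^ 2 + C + C, by positivity, fun s hs t ht hst => ?_⟩
  have hcont : Continuous fun u => ‖deriv γ u‖ := (hγ.continuous_deriv (by norm_num)).norm
  have hts : 0 ≤ t - s := sub_nonneg.2 hst
  have hd : ‖γ s - γ t‖ ≤ C * (t - s) := by
    have := (convex_Icc 0 L).norm_image_sub_le_of_norm_deriv_le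
      (fun x _ => hγ.differentiable (by simp) x) (fun x hx => (H x hx x hx).1) hs ht
    rwa [norm_sub_rev, Real.norm_eq_abs, abs_of_nonneg hts] at this
  have e1 : |angle (γ s) (γ t) - ‖γ s - γ t‖| ≤ C ^ 2 * (t - s) ^ 2 := by
    refine (abs_angle_sub_norm_sub_le (h1 s) (h1 t)).trans ?_
    rw [← mul_pow]
    exact pow_le_pow_left₀ (norm_nonneg _) hd 2
  have e2 : |‖γ s - γ t‖ - (t - s) * ‖deriv γ s‖| ≤ C * (t - s) ^ 2 := by
    have := (abs_norm_sub_norm_le (γ t - γ s) ((t - s) • deriv γ s)).trans (H s hs t ht).2.2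
    rwa [norm_smul, Real.norm_eq_abs, abs_of_nonneg hts, norm_sub_rev] at this
  have e3 : |(∫ u in s..t, ‖deriv γ u‖) - (t - s) * ‖deriv γ s‖| ≤ C * (t - s) ^ 2 := by
    have h2 : (∫ u in s..t, ‖deriv γ u‖) - (t - s) * ‖deriv γ s‖ =
        ∫ u in s..t, (‖deriv γ u‖ - ‖deriv γ s‖) := by
      rw [intervalIntegral.integral_sub (hcont.intervalIntegrable _ _)
        intervalIntegrable_const, intervalIntegral.integral_const, smul_eq_mul]
    rw [h2]
    have := intervalIntegral.norm_integral_le_of_norm_le_const (a := s) (b := t)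
      (f := fun u => ‖deriv γ u‖ - ‖deriv γ s‖) (C := C * (t - s)) (by
        intro u hu
        rw [uIoc_of_le hst] at hu
        have hu' : u ∈ Icc 0 L := ⟨hs.1.trans hu.1.le, hu.2.trans ht.2⟩
        refine (abs_norm_sub_norm_le _ _).trans ((H s hs u hu').2.1.trans ?_)
        rw [abs_of_nonneg (by linarith [hu.1])]
        exact mul_le_mul_of_nonneg_left (by linarith [hu.2]) hC)
    rw [Real.norm_eq_abs, abs_of_nonneg hts] at this
    linarith
  rw [abs_le] at e1 e2 e3 ⊢
  constructor <;> linarith [e1.1, e1.2, e2.1, e2.2, e3.1, e3.2]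

/-- Inscribed polygons: the sums of angles converge to the length of the curve. -/
theorem tendsto_sum_angle {γ : ℝ → E} (hγ : ContDiff ℝ 2 γ) (h1 : ∀ s, ‖γ s‖ = 1)
    {L : ℝ} (hL : 0 < L) :
    Tendsto (fun n : ℕ => ∑ i ∈ Finset.range n, angle (γ (i * L / n)) (γ ((i + 1 : ℕ) * L / n)))
      atTop (𝓝 (∫ u in (0 : ℝ)..L, ‖deriv γ u‖)) := by
  obtain ⟨C, hC, H⟩ := exists_angle_sub_integral_bound hγ h1 L
  have hcont : Continuous fun u => ‖deriv γ u‖ := (hγ.continuous_deriv (by norm_num)).norm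
  rw [tendsto_iff_norm_sub_tendsto_zero]
  refine squeeze_zero' (Eventually.of_forall fun _ => norm_nonneg _) ?_
    (tendsto_const_div_atTop_nhds_zero_nat (C * L ^ 2))
  filter_upwards [eventually_gt_atTop 0] with n hn
  have hn' : (0 : ℝ) < n := by exact_mod_cast hn
  have hsum := intervalIntegral.sum_integral_adjacent_intervals (μ := volume)
    (f := fun u => ‖deriv γ u‖) (a := fun i : ℕ => i * L / n) (n := n)
    (fun k _ => hcont.intervalIntegrable _ _)
  simp only [Nat.cast_zero, zero_mul, zero_div, mul_div_cancel_left₀ L hn'.ne'] at hsum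
  rw [← hsum, ← Finset.sum_sub_distrib]
  have hmem : ∀ i : ℕ, i ≤ n → i * L / n ∈ Icc 0 L := by
    intro i hi
    have : (i : ℝ) ≤ n := by exact_mod_cast hi
    refine ⟨by positivity, ?_⟩
    rw [div_le_iff₀ hn']; nlinarith
  calc _ ≤ ∑ i ∈ Finset.range n, C * (L / n) ^ 2 := by
        refine (norm_sum_le _ _).trans (Finset.sum_le_sum fun i hi => ?_)
        have hi := Finset.mem_range.1 hi
        have h2 : ((i + 1 : ℕ) : ℝ) * L / n - i * L / n = L / n := by push_cast; ring
        have := H _ (hmem i hi.le) _ (hmem (i + 1) hi)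
          (by rw [← sub_nonneg, h2]; positivity)
        rwa [h2] at this
    _ = C * L ^ 2 / n := by
        rw [Finset.sum_const, Finset.card_range, nsmul_eq_mul]; field_simp

variable [FiniteDimensional ℝ E] [MeasurableSpace E] [BorelSpace E]

/-- For almost every `v`, the function `s ↦ ⟪γ s, v⟫` has no degenerate zeros. -/
theorem ae_inner_deriv_ne_zero {γ : ℝ → E} (hγ : ContDiff ℝ 2 γ) (h1 : ∀ s, ‖γ s‖ = 1)
    {L : ℝ} (hL : 0 < L) :
    ∀ᵐ v : sphere (0 : E) 1 ∂(sphereArea E), ∀ s ∈ Icc 0 L,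
      inner ℝ (γ s) (v : E) = 0 → inner ℝ (deriv γ s) (v : E) ≠ 0 := by
  obtain ⟨C, hC, H⟩ := exists_taylor_bound hγ L
  obtain ⟨A, hA, hslab⟩ := exists_sphereArea_slab_le (E := E)
  rw [ae_iff]
  set B := {v : sphere (0 : E) 1 | ¬ ∀ s ∈ Icc 0 L,
      inner ℝ (γ s) (v : E) = 0 → inner ℝ (deriv γ s) (v : E) ≠ 0} with hB
  -- A degenerate zero forces `⟪γ, v⟫` to be of order `1 / n ^ 2` at the grid point just below it.
  -- So `B` is covered by `n + 1` slabs of total area `O(1 / n)`; the factor `2` comes from `n + 1 ≤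
  -- 2 * n`.
  have key : ∀ n : ℕ, 0 < n →
      sphereArea E B ≤ ENNReal.ofReal (2 * A * C * L ^ 2 / n) := by
    intro n hn
    have hn' : (0 : ℝ) < n := by exact_mod_cast hn
    have hn1 : (1 : ℝ) ≤ n := by exact_mod_cast hn
    -- The index `n` is needed for `s = L`.
    have hsub : B ⊆ ⋃ i ∈ Finset.range (n + 1),
        {v : sphere (0 : E) 1 | |inner ℝ (γ (i * L / n)) (v : E)| ≤ C * (L / n) ^ 2} := by
      intro v hv
      simp only [hB, mem_ofPred_eq, not_forall, not_not] at hv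
      obtain ⟨s, hs, hs0, hs1⟩ := hv
      have hk := Nat.floor_le (a := s * n / L) (by have := hs.1; positivity)
      have hk' := Nat.lt_floor_add_one (s * n / L)
      set k := ⌊s * n / L⌋₊
      have hkn : (k : ℝ) ≤ n := hk.trans (by
        rw [div_le_iff₀ hL]; nlinarith [hs.2])
      rw [le_div_iff₀ hL] at hk
      rw [div_lt_iff₀ hL] at hk'
      have hks : k * L / n ≤ s := by rw [div_le_iff₀ hn']; exact hk
      have hks' : s - k * L / n ≤ L / n := by
        rw [sub_le_iff_le_add, ← add_div, le_div_iff₀ hn']; linarith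
      simp only [mem_iUnion, Finset.mem_range, mem_ofPred_eq]
      refine ⟨k, by exact_mod_cast Nat.lt_succ_of_le (by exact_mod_cast hkn), ?_⟩
      have hT := (H s hs (k * L / n) ⟨by positivity, hks.trans hs.2⟩).2.2
      have hin : inner ℝ (γ (k * L / n)) (v : E) =
          inner ℝ (γ (k * L / n) - γ s - (k * L / n - s) • deriv γ s) (v : E) := by
        simp [inner_sub_left, inner_smul_left, hs0, hs1]
      rw [hin]
      refine (abs_real_inner_le_norm _ _).trans ?_
      have hv1 : ‖(v : E)‖ = 1 := by simp
      rw [hv1, mul_one]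
      refine hT.trans (mul_le_mul_of_nonneg_left ?_ hC)
      rw [← neg_sub, neg_sq]
      exact pow_le_pow_left₀ (by linarith) hks' 2
    calc sphereArea E B ≤ ∑ i ∈ Finset.range (n + 1), sphereArea E
          {v : sphere (0 : E) 1 | |inner ℝ (γ (i * L / n)) (v : E)| ≤ C * (L / n) ^ 2} :=
          (measure_mono hsub).trans (measure_biUnion_finset_le _ _)
      _ ≤ ∑ i ∈ Finset.range (n + 1), ENNReal.ofReal (A * (C * (L / n) ^ 2)) :=
          Finset.sum_le_sum fun i _ => hslab _ (h1 _) _ (by positivity)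
      _ = ENNReal.ofReal ((n + 1) * (A * (C * (L / n) ^ 2))) := by
          rw [Finset.sum_const, Finset.card_range, nsmul_eq_mul, ← ENNReal.ofReal_natCast,
            ← ENNReal.ofReal_mul (by positivity)]
          push_cast
          rfl
      _ ≤ _ := by
          apply ENNReal.ofReal_le_ofReal
          calc (n + 1) * (A * (C * (L / n) ^ 2)) ≤ (n + n) * (A * (C * (L / n) ^ 2)) := by gcongr
            _ = _ := by field_simp; ring
  have hlim : Tendsto (fun n : ℕ => ENNReal.ofReal (2 * A * C * L ^ 2 / n)) atTop (𝓝 0) := by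
    have := (ENNReal.tendsto_ofReal (tendsto_const_div_atTop_nhds_zero_nat (2 * A * C * L ^ 2)))
    simpa using this
  exact le_antisymm (ge_of_tendsto hlim
    (by filter_upwards [eventually_gt_atTop 0] with n hn using key n hn)) zero_le

end Curve

/-! ### Counting zeros by sign changes on a grid. -/

section Zeros

variable {f : ℝ → ℝ} {L : ℝ}

/-- The zeros of `f` on the half-open interval `[0, L)`. -/
def zeroSet (f : ℝ → ℝ) (L : ℝ) : Set ℝ := {s ∈ Ico 0 L | f s = 0}

/-- The indices of the pieces of the uniform partition of `[0, L]` into `n` pieces over which `f`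
changes sign. -/
noncomputable def signChanges (f : ℝ → ℝ) (L : ℝ) (n : ℕ) : Finset ℕ :=
  {i ∈ Finset.range n | f (i * L / n) * f ((i + 1 : ℕ) * L / n) < 0}

/-- Infinitely many zeros would accumulate at a zero in the compact interval, which a nonzero
derivative there forbids. -/
theorem finite_zeroSet (hf : Differentiable ℝ f)
    (hnd : ∀ s ∈ Icc 0 L, f s = 0 → deriv f s ≠ 0) : (zeroSet f L).Finite := by
  have hZ : IsCompact (Icc 0 L ∩ f ⁻¹' {0}) :=
    isCompact_Icc.inter_right (isClosed_singleton.preimage hf.continuous)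
  have hfin : (Icc 0 L ∩ f ⁻¹' {0}).Finite := by
    by_contra h
    obtain ⟨x, hx, hacc⟩ := Set.Infinite.exists_accPt_of_subset_isCompact h hZ Subset.rfl
    rw [accPt_iff_frequently_nhdsNE] at hacc
    have := (hf x).hasDerivAt.eventually_ne (c := 0) (hnd x hx.1 hx.2)
    exact hacc (this.mono fun y hy h' => hy h'.2)
  exact hfin.subset fun s hs => ⟨Ico_subset_Icc_self hs.1, hs.2⟩

/-- The intermediate value theorem puts a zero strictly inside each piece with a sign change, and
these open pieces are disjoint. Holding for every `n`, the bound later supplies the dominating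
function. -/
theorem card_signChanges_le (hf : Continuous f) (hL : 0 < L) (hZ : (zeroSet f L).Finite) (n : ℕ) :
    (signChanges f L n).card ≤ (zeroSet f L).ncard := by
  have key : ∀ i ∈ signChanges f L n, ∃ z, i * L / n < z ∧ z < (i + 1 : ℕ) * L / n ∧ f z = 0 := by
    intro i hi
    have hi2 := (Finset.mem_filter.1 hi).2
    have hn : (0 : ℝ) < n := by
      exact_mod_cast (Nat.zero_le i).trans_lt (Finset.mem_range.1 (Finset.mem_filter.1 hi).1)
    have hle : i * L / n ≤ (i + 1 : ℕ) * L / n := by push_cast; gcongr; linarith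
    have h0 : (0 : ℝ) ∈ uIcc (f (i * L / n)) (f ((i + 1 : ℕ) * L / n)) := by
      rcases mul_neg_iff.1 hi2 with ⟨h1, h2⟩ | ⟨h1, h2⟩
      · exact mem_uIcc_of_ge h2.le h1.le
      · exact mem_uIcc_of_le h1.le h2.le
    obtain ⟨z, hz, hz0⟩ := intermediate_value_uIcc hf.continuousOn h0
    rw [uIcc_of_le hle] at hz
    refine ⟨z, hz.1.lt_of_ne ?_, hz.2.lt_of_ne ?_, hz0⟩
    · rintro rfl; simp [hz0] at hi2
    · rintro rfl; rw [hz0, mul_zero] at hi2; exact hi2.false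
  choose! z hz1 hz2 hz0 using key
  rw [Set.ncard_eq_toFinset_card _ hZ]
  have hn : ∀ i ∈ signChanges f L n, i < n := fun i hi =>
    Finset.mem_range.1 (Finset.mem_filter.1 hi).1
  refine Finset.card_le_card_of_injOn z ?_ ?_
  · intro i hi
    have hin := hn i hi
    have hn' : (0 : ℝ) < n := by exact_mod_cast (Nat.zero_le i).trans_lt hin
    have h1 : ((i + 1 : ℕ) : ℝ) ≤ n := by exact_mod_cast hin
    simp only [Finite.coe_toFinset]
    refine ⟨⟨?_, ?_⟩, hz0 i hi⟩
    · exact le_trans (by positivity) (hz1 i hi).le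
    · refine (hz2 i hi).trans_le ?_
      rw [div_le_iff₀ hn']; nlinarith
  · have hlt : ∀ i ∈ signChanges f L n, ∀ j ∈ signChanges f L n, i < j → z i < z j := by
      intro i hi j hj hij
      have h1 : ((i + 1 : ℕ) : ℝ) ≤ j := by exact_mod_cast hij
      refine (hz2 i hi).trans (lt_of_le_of_lt ?_ (hz1 j hj))
      gcongr
    intro i hi j hj hij
    rcases lt_trichotomy i j with h | h | h
    · exact absurd hij (hlt i hi j hj h).ne
    · exact h
    · exact absurd hij (hlt j hj i hi h).ne'

theorem eventually_mul_pos_of_deriv_ne_zero {s : ℝ} (hf : DifferentiableAt ℝ f s) (h0 : f s = 0)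
    (hd : deriv f s ≠ 0) : ∀ᶠ z in 𝓝[≠] s, 0 < deriv f s * f z * (z - s) := by
  have h1 := (hasDerivAt_iff_tendsto_slope.1 hf.hasDerivAt).const_mul (deriv f s)
  filter_upwards [h1.eventually (lt_mem_nhds (mul_self_pos.2 hd)), self_mem_nhdsWithin] with z h2 hz
  have hz' : z - s ≠ 0 := sub_ne_zero.2 hz
  rw [slope_def_field, h0, sub_zero] at h2
  have h3 : deriv f s * f z * (z - s) = deriv f s * (f z / (z - s)) * (z - s) ^ 2 := by
    field_simp
  rw [h3]
  positivity

/-- Once the mesh is fine enough, each simple zero lies strictly inside a piece whose endpoints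
carry opposite signs, and no other zero is within `L / n` of it. Distinct zeros then give distinct
pieces. -/
theorem eventually_card_signChanges_eq (hf : Differentiable ℝ f) (hL : 0 < L)
    (hnd : ∀ s ∈ Icc 0 L, f s = 0 → deriv f s ≠ 0)
    (hgrid : ∀ n i : ℕ, f (i * L / n) ≠ 0) :
    ∀ᶠ n in atTop, (signChanges f L n).card = (zeroSet f L).ncard := by
  have hZ := finite_zeroSet hf hnd
  have hev : ∀ᶠ n : ℕ in atTop, ∀ s ∈ zeroSet f L, ∀ z, z ≠ s → |z - s| ≤ L / n →
      0 < deriv f s * f z * (z - s) := by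
    rw [eventually_all_finite hZ]
    intro s hs
    have h1 := eventually_mul_pos_of_deriv_ne_zero (hf s) hs.2
      (hnd s (Ico_subset_Icc_self hs.1) hs.2)
    rw [eventually_nhdsWithin_iff, Metric.eventually_nhds_iff] at h1
    obtain ⟨ε, hε, h1⟩ := h1
    filter_upwards [(tendsto_const_div_atTop_nhds_zero_nat L).eventually (gt_mem_nhds hε)]
      with n hn z hz hzs
    exact h1 (by rw [Real.dist_eq]; exact hzs.trans_lt hn) hz
  filter_upwards [hev, eventually_gt_atTop 0] with n hn hn0
  refine le_antisymm (card_signChanges_le hf.continuous hL hZ n) ?_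
  have hn' : (0 : ℝ) < n := by exact_mod_cast hn0
  have hfloor : ∀ s ∈ zeroSet f L, (⌊s * n / L⌋₊ : ℝ) * L / n < s ∧
      s < (⌊s * n / L⌋₊ + 1 : ℕ) * L / n := by
    intro s hs
    have hk := Nat.floor_le (a := s * n / L) (by have := hs.1.1; positivity)
    have hk' := Nat.lt_floor_add_one (s * n / L)
    rw [le_div_iff₀ hL] at hk
    rw [div_lt_iff₀ hL] at hk'
    refine ⟨lt_of_le_of_ne ((div_le_iff₀ hn').2 hk) ?_, ?_⟩
    · intro h
      have := hs.2
      rw [← h] at this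
      exact hgrid _ _ this
    · push_cast
      exact (lt_div_iff₀ hn').2 hk'
  have hstep : ∀ k : ℕ, ((k + 1 : ℕ) : ℝ) * L / n = k * L / n + L / n := by
    intro k; push_cast; ring
  rw [Set.ncard_eq_toFinset_card _ hZ]
  refine Finset.card_le_card_of_injOn (fun s => ⌊s * n / L⌋₊) ?_ ?_
  · intro s hs
    rw [Finite.coe_toFinset] at hs
    obtain ⟨h1, h2⟩ := hfloor s hs
    have hlt : ⌊s * n / L⌋₊ < n := by
      rw [Nat.floor_lt (by have := hs.1.1; positivity), div_lt_iff₀ hL]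
      nlinarith [hs.1.2]
    simp only [signChanges, Finset.coe_filter, Finset.mem_range, mem_ofPred_eq]
    refine ⟨hlt, ?_⟩
    set k := ⌊s * n / L⌋₊
    have h3 := hstep k
    have p1 := hn s hs (k * L / n) h1.ne (by rw [abs_of_neg (by linarith)]; linarith)
    have p2 := hn s hs ((k + 1 : ℕ) * L / n) h2.ne' (by rw [abs_of_pos (by linarith)]; linarith)
    have q1 : deriv f s * f (k * L / n) < 0 := by
      by_contra h; nlinarith
    have q2 : 0 < deriv f s * f ((k + 1 : ℕ) * L / n) := by
      by_contra h; nlinarith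
    have q3 := mul_neg_of_neg_of_pos q1 q2
    by_contra h
    have q4 := mul_nonneg (mul_self_nonneg (deriv f s)) (not_lt.1 h)
    linarith
  · intro s hs t ht hst
    rw [Finite.coe_toFinset] at hs ht
    by_contra hne
    obtain ⟨h1, h2⟩ := hfloor s hs
    obtain ⟨h3, h4⟩ := hfloor t ht
    have h5 := hstep ⌊s * n / L⌋₊
    simp only at hst
    rw [← hst] at h3 h4
    have := hn s hs t (Ne.symm hne) (by rw [abs_le]; constructor <;> linarith)
    rw [ht.2] at this
    simp at this

end Zeros

/-! ### Crofton's formula by passage to the limit. -/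

section Crofton

/-- Fatou's lemma. Measurability of `f` comes from the almost everywhere limit, so the zero count
needs no separate measurability argument. -/
theorem integrable_of_tendsto_of_bdd_lintegral {α : Type*} [MeasurableSpace α] {μ : Measure α}
    {G : ℕ → α → ℝ} {f : α → ℝ} (hGf : ∀ᵐ x ∂μ, Tendsto (fun n => G n x) atTop (𝓝 (f x)))
    (hG : ∀ n, AEStronglyMeasurable (G n) μ)
    (hG' : liminf (fun n => ∫⁻ x, ‖G n x‖ₑ ∂μ) atTop ≠ ⊤) : Integrable f μ := by
  refine ⟨aestronglyMeasurable_of_tendsto_ae _ hG hGf, lt_of_le_of_lt ?_ hG'.lt_top⟩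
  have h : ∫⁻ x, ‖f x‖ₑ ∂μ = ∫⁻ x, liminf (fun n => ‖G n x‖ₑ) atTop ∂μ :=
    lintegral_congr_ae (by filter_upwards [hGf] with x hx using hx.enorm.liminf_eq.symm)
  rw [h]
  exact lintegral_liminf_le' fun n => (hG n).aemeasurable.enorm

variable {E : Type*} [NormedAddCommGroup E] [InnerProductSpace ℝ E]

theorem card_signChanges_eq_sum_indicator (γ : ℝ → E) (L : ℝ) (n : ℕ) (v : sphere (0 : E) 1) :
    ((signChanges (fun s => inner ℝ (γ s) (v : E)) L n).card : ℝ) =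
      ∑ i ∈ Finset.range n,
        (signChangeSet (γ (i * L / n)) (γ ((i + 1 : ℕ) * L / n))).indicator (fun _ => (1 : ℝ)) v := by
  classical
  rw [signChanges, Finset.card_filter]
  push_cast
  refine Finset.sum_congr rfl fun i _ => ?_
  simp [Set.indicator_apply, signChangeSet]

variable [MeasurableSpace E] [BorelSpace E]

theorem measurable_card_signChanges (γ : ℝ → E) (L : ℝ) (n : ℕ) :
    Measurable fun v : sphere (0 : E) 1 =>
      ((signChanges (fun s => inner ℝ (γ s) (v : E)) L n).card : ℝ) := by
  simp only [card_signChanges_eq_sum_indicator]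
  exact Finset.measurable_sum _ fun i _ =>
    measurable_const.indicator (measurableSet_signChangeSet _ _)

variable [FiniteDimensional ℝ E]

theorem integrable_card_signChanges (γ : ℝ → E) (L : ℝ) (n : ℕ) :
    Integrable (fun v : sphere (0 : E) 1 =>
      ((signChanges (fun s => inner ℝ (γ s) (v : E)) L n).card : ℝ)) (sphereArea E) := by
  simp only [card_signChanges_eq_sum_indicator]
  exact integrable_finsetSum _ fun i _ =>
    (integrable_const _).indicator (measurableSet_signChangeSet _ _)

theorem integral_card_signChanges {γ : ℝ → E} (h1 : ∀ s, ‖γ s‖ = 1) (L : ℝ) (n : ℕ) :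
    ∫ v : sphere (0 : E) 1, ((signChanges (fun s => inner ℝ (γ s) (v : E)) L n).card : ℝ)
      ∂(sphereArea E) = (∑ i ∈ Finset.range n, angle (γ (i * L / n)) (γ ((i + 1 : ℕ) * L / n))) *
        ((sphereArea E).real univ / Real.pi) := by
  simp only [card_signChanges_eq_sum_indicator]
  rw [integral_finsetSum _ fun i _ =>
    (integrable_const _).indicator (measurableSet_signChangeSet _ _), Finset.sum_mul]
  refine Finset.sum_congr rfl fun i _ => ?_
  rw [integral_indicator_const _ (measurableSet_signChangeSet _ _),
    sphereArea_signChangeSet (h1 _) (h1 _), smul_eq_mul, mul_one]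
  ring

theorem ae_tendsto_card_signChanges {γ : ℝ → E} (hγ : ContDiff ℝ 2 γ) (h1 : ∀ s, ‖γ s‖ = 1)
    {L : ℝ} (hL : 0 < L) : ∀ᵐ v : sphere (0 : E) 1 ∂(sphereArea E),
      (zeroSet (fun s => inner ℝ (γ s) (v : E)) L).Finite ∧
      Tendsto (fun n => ((signChanges (fun s => inner ℝ (γ s) (v : E)) L n).card : ℝ)) atTop
        (𝓝 ((zeroSet (fun s => inner ℝ (γ s) (v : E)) L).ncard : ℝ)) := by
  -- There are countably many grid points over all `n`, and each excludes only a null great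
  -- hypersphere.
  have hgrid : ∀ᵐ v : sphere (0 : E) 1 ∂(sphereArea E), ∀ n i : ℕ,
      inner ℝ (γ (i * L / n)) (v : E) ≠ 0 :=
    ae_all_iff.2 fun n => ae_all_iff.2 fun i => ae_sphereArea_inner_ne_zero (h1 _)
  have hdiff : Differentiable ℝ γ := hγ.differentiable (by simp)
  filter_upwards [hgrid, ae_inner_deriv_ne_zero hγ h1 hL] with v hv1 hv2
  have hd : ∀ s, HasDerivAt (fun s => inner ℝ (γ s) (v : E)) (inner ℝ (deriv γ s) (v : E)) s := by
    intro s
    simpa using (hdiff s).hasDerivAt.inner ℝ (hasDerivAt_const s (v : E))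
  have hf : Differentiable ℝ fun s => inner ℝ (γ s) (v : E) := fun s => (hd s).differentiableAt
  have hnd : ∀ s ∈ Icc 0 L, inner ℝ (γ s) (v : E) = 0 →
      deriv (fun s => inner ℝ (γ s) (v : E)) s ≠ 0 := by
    intro s hs h0
    rw [(hd s).deriv]
    exact hv2 s hs h0
  refine ⟨finite_zeroSet hf hnd, tendsto_const_nhds.congr' ?_⟩
  filter_upwards [eventually_card_signChanges_eq hf hL hnd hv1] with n hn
  rw [hn]

/-- Crofton's formula for a curve on the unit sphere. -/
theorem integrable_ncard_zeroSet_and_integral_eq {γ : ℝ → E} (hγ : ContDiff ℝ 2 γ)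
    (h1 : ∀ s, ‖γ s‖ = 1) {L : ℝ} (hL : 0 < L) :
    Integrable (fun v : sphere (0 : E) 1 =>
      ((zeroSet (fun s => inner ℝ (γ s) (v : E)) L).ncard : ℝ)) (sphereArea E) ∧
    ∫ v : sphere (0 : E) 1, ((zeroSet (fun s => inner ℝ (γ s) (v : E)) L).ncard : ℝ)
      ∂(sphereArea E) =
      (∫ s in (0 : ℝ)..L, ‖deriv γ s‖) * ((sphereArea E).real univ / Real.pi) := by
  have hae := ae_tendsto_card_signChanges hγ h1 hL
  have hlim : Tendsto (fun n => ∫ v : sphere (0 : E) 1,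
      ((signChanges (fun s => inner ℝ (γ s) (v : E)) L n).card : ℝ) ∂(sphereArea E)) atTop
      (𝓝 ((∫ s in (0 : ℝ)..L, ‖deriv γ s‖) * ((sphereArea E).real univ / Real.pi))) := by
    simp only [integral_card_signChanges h1]
    exact (tendsto_sum_angle hγ h1 hL).mul_const _
  have hint : Integrable (fun v : sphere (0 : E) 1 =>
      ((zeroSet (fun s => inner ℝ (γ s) (v : E)) L).ncard : ℝ)) (sphereArea E) := by
    refine integrable_of_tendsto_of_bdd_lintegral (hae.mono fun v hv => hv.2)
      (fun n => (measurable_card_signChanges γ L n).aestronglyMeasurable) ?_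
    have h2 : ∀ n, ∫⁻ v : sphere (0 : E) 1,
        ‖((signChanges (fun s => inner ℝ (γ s) (v : E)) L n).card : ℝ)‖ₑ ∂(sphereArea E) =
        ENNReal.ofReal (∫ v : sphere (0 : E) 1,
          ((signChanges (fun s => inner ℝ (γ s) (v : E)) L n).card : ℝ) ∂(sphereArea E)) := by
      intro n
      rw [ofReal_integral_eq_lintegral_ofReal (integrable_card_signChanges γ L n)
        (Eventually.of_forall fun _ => by positivity)]
      exact lintegral_congr fun v => Real.enorm_eq_ofReal (by positivity)
    simp only [h2]
    rw [(ENNReal.tendsto_ofReal hlim).liminf_eq]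
    exact ENNReal.ofReal_ne_top
  refine ⟨hint, tendsto_nhds_unique ?_ hlim⟩
  refine tendsto_integral_of_dominated_convergence _
    (fun n => (measurable_card_signChanges γ L n).aestronglyMeasurable) hint ?_
    (hae.mono fun v hv => hv.2)
  intro n
  filter_upwards [hae] with v hv
  rw [Real.norm_of_nonneg (by positivity)]
  have hc : Continuous fun s => inner ℝ (γ s) (v : E) := hγ.continuous.inner continuous_const
  exact_mod_cast card_signChanges_le hc hL hv.1 n

end Crofton

/-! ### From critical points on the knot to zeros of `⟪ν, v⟫`. -/

section Knot

variable {U : Type*} [NormedAddCommGroup U] [NormedSpace ℝ U]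
  {x : ℝ → U} {L : ℝ} {K : Set U}

theorem deriv_comp_eq_xi (hx : ContDiff ℝ ∞ x) (v : SmoothFn U) (s : ℝ) :
    deriv (fun t => v (x t)) s = xi x s v :=
  ((v.differentiableAt (x s)).hasFDerivAt.comp_hasDerivAt s
    (hx.differentiable (by simp) s).hasDerivAt).deriv

theorem contDiff_xi (hx : ContDiff ℝ ∞ x) (v : SmoothFn U) : ContDiff ℝ ∞ fun s => xi x s v := by
  have h1 : ContDiff ℝ ∞ fun t => v (x t) := v.contMDiff.contDiff.comp hx
  have h2 : (fun s => xi x s v) = deriv fun t => v (x t) :=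
    funext fun s => (deriv_comp_eq_xi hx v s).symm
  rw [h2]
  exact (contDiff_infty_iff_deriv.1 h1).2

theorem periodic_xi (hx : Function.Periodic x L) : Function.Periodic (xi x) L := by
  intro s
  have h1 : deriv x (s + L) = deriv x s := by
    rw [← deriv_comp_add_const x L s]
    exact congrArg (fun g => deriv g s) (funext hx)
  ext v
  change fderiv ℝ v (x (s + L)) (deriv x (s + L)) = fderiv ℝ v (x s) (deriv x s)
  rw [h1, hx s]

variable {E : Type*} [NormedAddCommGroup E] [InnerProductSpace ℝ E] [FiniteDimensional ℝ E]
  {ι : E →ₗ[ℝ] SmoothFn U}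

/-- In an orthonormal basis, the coordinates are derivatives of smooth functions along `x`. -/
theorem contDiff_dualVector (hx : ContDiff ℝ ∞ x) (ι : E →ₗ[ℝ] SmoothFn U) :
    ContDiff ℝ ∞ fun s => dualVector (xi x s ∘ₗ ι) := by
  let b := stdOrthonormalBasis ℝ E
  have h : (fun s => dualVector (xi x s ∘ₗ ι)) = fun s => ∑ i, xi x s (ι (b i)) • b i := by
    funext s
    rw [← b.sum_repr' (dualVector (xi x s ∘ₗ ι))]
    refine Finset.sum_congr rfl fun i _ => ?_
    rw [real_inner_comm, inner_dualVector]
    rfl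
  rw [h]
  exact ContDiff.sum fun i _ => (contDiff_xi hx _).smul contDiff_const

/-- Periodicity carries nonvanishing from `[0, L]` to all of `ℝ`, so that `nu` is smooth on the
whole line. -/
theorem dualVector_ne_zero (hx : IsArclengthParam x L K)
    (hnd : ∀ s ∈ Icc 0 L, ∃ v : E, xi x s (ι v) ≠ 0) (s : ℝ) :
    dualVector (xi x s ∘ₗ ι) ≠ 0 := by
  obtain ⟨t, ht, hst⟩ := (periodic_xi hx.periodic).exists_mem_Ico₀ hx.length_pos s
  rw [hst]
  obtain ⟨v, hv⟩ := hnd t (Ico_subset_Icc_self ht)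
  intro h
  apply hv
  have := inner_dualVector (xi x t ∘ₗ ι) v
  rw [h, inner_zero_left] at this
  exact this.symm

theorem norm_nu (hx : IsArclengthParam x L K)
    (hnd : ∀ s ∈ Icc 0 L, ∃ v : E, xi x s (ι v) ≠ 0) (s : ℝ) : ‖nu x ι s‖ = 1 :=
  norm_smul_inv_norm (𝕜 := ℝ) (dualVector_ne_zero hx hnd s)

theorem contDiff_nu (hx : IsArclengthParam x L K)
    (hnd : ∀ s ∈ Icc 0 L, ∃ v : E, xi x s (ι v) ≠ 0) : ContDiff ℝ ∞ (nu x ι) := by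
  have h := contDiff_dualVector hx.smooth ι
  have h0 := dualVector_ne_zero hx hnd
  exact ((h.norm ℝ h0).inv fun s => norm_ne_zero_iff.2 (h0 s)).smul h

theorem deriv_comp_eq_norm_mul_inner_nu (hx : IsArclengthParam x L K)
    (hnd : ∀ s ∈ Icc 0 L, ∃ v : E, xi x s (ι v) ≠ 0) (v : E) (s : ℝ) :
    deriv (fun t => ι v (x t)) s = ‖dualVector (xi x s ∘ₗ ι)‖ * inner ℝ (nu x ι s) v := by
  have h0 := norm_ne_zero_iff.2 (dualVector_ne_zero hx hnd s)
  rw [deriv_comp_eq_xi hx.smooth, nu, inner_smul_left, inner_dualVector]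
  simp only [conj_trivial, mul_inv_cancel_left₀ h0]
  rfl

theorem deriv_comp_eq_zero_iff (hx : IsArclengthParam x L K)
    (hnd : ∀ s ∈ Icc 0 L, ∃ v : E, xi x s (ι v) ≠ 0) (v : E) (s : ℝ) :
    deriv (fun t => ι v (x t)) s = 0 ↔ inner ℝ (nu x ι s) v = 0 := by
  rw [deriv_comp_eq_norm_mul_inner_nu hx hnd, mul_eq_zero,
    or_iff_right (norm_ne_zero_iff.2 (dualVector_ne_zero hx hnd s))]

theorem criticalPoints_eq_image_zeroSet (hx : IsArclengthParam x L K)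
    (hnd : ∀ s ∈ Icc 0 L, ∃ v : E, xi x s (ι v) ≠ 0) (v : E) :
    criticalPoints x (ι v) = x '' zeroSet (fun s => inner ℝ (nu x ι s) v) L := by
  ext p
  constructor
  · rintro ⟨s, rfl, hs⟩
    -- Pairing the two maps yields a single representative in `[0, L)` that serves both.
    have hper : Function.Periodic (fun s => (x s, xi x s)) L := fun s => by
      simp only [hx.periodic s, periodic_xi hx.periodic s]
    obtain ⟨t, ht, hst⟩ := hper.exists_mem_Ico₀ hx.length_pos s
    obtain ⟨h1, h2⟩ := Prod.ext_iff.1 hst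
    simp only at h1 h2
    rw [deriv_comp_eq_xi hx.smooth, h2, ← deriv_comp_eq_xi hx.smooth,
      deriv_comp_eq_zero_iff hx hnd] at hs
    exact ⟨t, ⟨ht, hs⟩, h1.symm⟩
  · rintro ⟨s, ⟨-, hs⟩, rfl⟩
    exact ⟨s, rfl, (deriv_comp_eq_zero_iff hx hnd v s).2 hs⟩

theorem criticalCount_eq_ncard_zeroSet (hx : IsArclengthParam x L K)
    (hnd : ∀ s ∈ Icc 0 L, ∃ v : E, xi x s (ι v) ≠ 0) (v : E) :
    criticalCount x (ι v) = (zeroSet (fun s => inner ℝ (nu x ι s) v) L).ncard := by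
  rw [criticalCount, criticalPoints_eq_image_zeroSet hx hnd,
    InjOn.ncard_image (hx.injOn.mono fun s hs => hs.1)]

theorem isMorseAlong_of_inner_deriv_nu_ne_zero (hx : IsArclengthParam x L K)
    (hnd : ∀ s ∈ Icc 0 L, ∃ v : E, xi x s (ι v) ≠ 0) {v : E}
    (hv : ∀ s ∈ Icc 0 L, inner ℝ (nu x ι s) v = 0 → inner ℝ (deriv (nu x ι) s) v ≠ 0) :
    IsMorseAlong x (ι v) := by
  intro s hs
  have hf : (deriv fun t => ι v (x t)) =
      fun s => ‖dualVector (xi x s ∘ₗ ι)‖ * inner ℝ (nu x ι s) v :=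
    funext (deriv_comp_eq_norm_mul_inner_nu hx hnd v)
  have hper : Function.Periodic (fun s => (nu x ι s, deriv (nu x ι) s)) L := by
    have h1 : Function.Periodic (nu x ι) L := fun s => by
      simp only [nu, periodic_xi hx.periodic s]
    intro s
    have h2 : deriv (nu x ι) (s + L) = deriv (nu x ι) s := by
      rw [← deriv_comp_add_const (nu x ι) L s]
      exact congrArg (fun g => deriv g s) (funext h1)
    simp only [h1 s, h2]
  obtain ⟨t, ht, hst⟩ := hper.exists_mem_Ico₀ hx.length_pos s
  obtain ⟨h1, h2⟩ := Prod.ext_iff.1 hst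
  simp only at h1 h2
  have hs0 := (deriv_comp_eq_zero_iff hx hnd v s).1 hs
  have hne : inner ℝ (deriv (nu x ι) s) v ≠ 0 := by
    rw [h2]
    exact hv t (Ico_subset_Icc_self ht) (h1 ▸ hs0)
  have hu : DifferentiableAt ℝ (fun s => ‖dualVector (xi x s ∘ₗ ι)‖) s :=
    ((contDiff_dualVector hx.smooth ι).norm ℝ (dualVector_ne_zero hx hnd)).differentiable
      (by simp) s
  have hν : HasDerivAt (fun s => inner ℝ (nu x ι s) v) (inner ℝ (deriv (nu x ι) s) v) s := by
    simpa using ((contDiff_nu hx hnd).differentiable (by simp) s).hasDerivAt.inner ℝ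
      (hasDerivAt_const s v)
  -- At a critical point the term of the product rule with the derivative of `‖ξ†‖` vanishes.
  rw [hf, (hu.hasDerivAt.fun_mul hν).deriv, hs0, mul_zero, zero_add]
  exact mul_ne_zero (norm_ne_zero_iff.2 (dualVector_ne_zero hx hnd s)) hne

variable [MeasurableSpace E] [BorelSpace E]

/-- The average number of critical points along a knot, for a Euclidean space `E` of functions
with inclusion `ι` in the space of smooth functions. -/
theorem average_criticalCount (hx : IsArclengthParam x L K)
    (hnd : ∀ s ∈ Icc 0 L, ∃ v : E, xi x s (ι v) ≠ 0) :
    (∀ᵐ v : sphere (0 : E) 1 ∂(sphereArea E),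
      IsMorseAlong x (ι v) ∧ (criticalPoints x (ι v)).Finite) ∧
    Integrable (fun v : sphere (0 : E) 1 => (criticalCount x (ι v) : ℝ)) (sphereArea E) ∧
    1 / (sphereArea E).real univ *
        ∫ v : sphere (0 : E) 1, (criticalCount x (ι v) : ℝ) ∂(sphereArea E) =
      1 / Real.pi * ∫ s in (0 : ℝ)..L, ‖deriv (nu x ι) s‖ := by
  have hν : ContDiff ℝ 2 (nu x ι) := (contDiff_nu hx hnd).of_le (by norm_cast)
  have h1 := norm_nu hx hnd
  have hL := hx.length_pos
  simp only [criticalCount_eq_ncard_zeroSet hx hnd]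
  obtain ⟨hint, heq⟩ := integrable_ncard_zeroSet_and_integral_eq hν h1 hL
  refine ⟨?_, hint, ?_⟩
  · filter_upwards [ae_inner_deriv_ne_zero hν h1 hL, ae_tendsto_card_signChanges hν h1 hL]
      with v hv hv'
    refine ⟨isMorseAlong_of_inner_deriv_nu_ne_zero hx hnd hv, ?_⟩
    rw [criticalPoints_eq_image_zeroSet hx hnd]
    exact hv'.1.image x
  -- The unit vector `nu x ι 0` makes `E` nontrivial, so the total area is nonzero and cancels.
  · have : Nontrivial E := ⟨nu x ι 0, 0, by intro h; simpa [h] using h1 0⟩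
    have hpos : (sphereArea E).real univ ≠ 0 := by
      rw [measureReal_ne_zero_iff, Measure.measure_univ_ne_zero]
      exact Measure.toSphere_ne_zero volume
    rw [heq]
    field_simp

end Knot

end KnotStat

open KnotStat in
theorem theorem1p1 {U : Type*} [NormedAddCommGroup U] [InnerProductSpace ℝ U]
    [FiniteDimensional ℝ U] (K : Set U) (hK : IsSmoothKnot K)
    (x : ℝ → U) (L : ℝ) (hx : IsArclengthParam x L K)
    (V : Submodule ℝ (SmoothFn U)) [FiniteDimensional ℝ V] (ip : InnerProductSpace.Core ℝ V)
    (hnd : ∀ s ∈ Set.Icc 0 L, ∃ v ∈ V, fderiv ℝ (v : U → ℝ) (x s) (deriv x s) ≠ 0) :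
    -- the Euclidean structure on `V` given by the inner product `ip`, with its Borel sets
    letI : NormedAddCommGroup V := ip.toNormedAddCommGroup
    letI : InnerProductSpace ℝ V := InnerProductSpace.ofCore ip.toCore
    letI : MeasurableSpace V := borel V
    haveI : BorelSpace V := ⟨rfl⟩
    (∀ᵐ v : Metric.sphere (0 : V) 1 ∂(sphereArea V),
      IsMorseAlong x v.1.1 ∧ (criticalPoints x v.1.1).Finite) ∧
    Integrable (fun v : Metric.sphere (0 : V) 1 => (criticalCount x v.1.1 : ℝ))
      (sphereArea V) ∧
    1 / (sphereArea V).real Set.univ *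
        ∫ v : Metric.sphere (0 : V) 1, (criticalCount x v.1.1 : ℝ) ∂(sphereArea V) =
      1 / Real.pi * ∫ s in (0 : ℝ)..L, ‖deriv (nu x V.subtype) s‖ := by
  let : NormedAddCommGroup V := ip.toNormedAddCommGroup
  let : InnerProductSpace ℝ V := InnerProductSpace.ofCore ip.toCore
  let : MeasurableSpace V := borel V
  have : BorelSpace V := ⟨rfl⟩
  exact average_criticalCount (ι := V.subtype) hx fun s hs =>
    let ⟨v, hv, h⟩ := hnd s hs
    ⟨⟨v, hv⟩, h⟩
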